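/- Let $m\ge 1$ and $c\ge 1$ be integers. The hardware graph $F(m,c)$ has $2cm^2$ vertices, arranged in an $m\times m$ array of cells; each cell consists of $c$ left and $c$ right vertices which form a complete bipartite graph $K_{c,c}$; in addition, each left vertex is joined to the left vertex in the same position of the cells directly above and below, each right vertex is joined to the right vertex in the same position of the cells directly to the left and to the right, and there are no other edges. The problem graph of a quadratic unconstrained binary optimization (QUBO) problem $\arg\min_{x} x^{T}\mathbf{P}x$ over binary vectors $x$, with $\mathbf{P}$ a symmetric real matrix, has the variables as vertices and an edge between distinct $i,j$ exactly when $\mathbf{P}_{ij}\neq 0$. A graph $G$ is minor-embeddable in a graph $H$ (is a minor of $H$) if one can assign to each vertex $v$ of $G$ the vertex set of a subtree $T_v$ of $H$, so that $T_u$ and $T_v$ are vertex-disjoint for $u\ne v$ and, for every edge $uv$ of $G$, $H$ has an edge between a vertex of $T_u$ and a vertex of $T_v$. If the problem graph of a QUBO problem contains the $c(m+1)\times c(m+1)$ planar grid as a subgraph (not necessarily induced, up to isomorphism) or as a minor, then this problem graph is not minor-embeddable in $F(m,c)$. -/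

import Mathlib

namespace QuantumEmbedding

/-- The problem graph of the QUBO problem `argmin xᵀ P x` over binary vectors `x` indexed by the
finite set of variables `V`: two distinct variables are adjacent when their coefficient in the
symmetric matrix `P` is nonzero. -/
def problemGraph {V : Type*} (P : Matrix V V ℝ) (hP : P.IsSymm) : SimpleGraph V where
  Adj i j := i ≠ j ∧ P i j ≠ 0
  symm := ⟨fun i j h => ⟨h.1.symm, by rw [hP.apply i j]; exact h.2⟩⟩
  loopless := ⟨fun _ h => h.1 rfl⟩

/-- `φ` is a minor embedding of `G` into `H`: every vertex of `G` is mapped to the vertex set of a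
subtree of `H`, distinct vertices are mapped to disjoint sets, and every edge `uv` of `G` is
realized by an edge of `H` between `φ u` and `φ v`. -/
structure IsMinorEmbedding {V W : Type*} (G : SimpleGraph V) (H : SimpleGraph W)
    (φ : V → Set W) : Prop where
  subtree : ∀ v, ∃ T : H.Subgraph, T.coe.IsTree ∧ T.verts = φ v
  disjoint : ∀ u v, u ≠ v → Disjoint (φ u) (φ v)
  edge : ∀ u v, G.Adj u v → ∃ x ∈ φ u, ∃ y ∈ φ v, H.Adj x y

/-- `G` is minor-embeddable in `H`, i.e. `G` is a minor of `H`. -/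
def MinorEmbeddable {V W : Type*} (G : SimpleGraph V) (H : SimpleGraph W) : Prop :=
  ∃ φ : V → Set W, IsMinorEmbedding G H φ

/-- The `k × l` planar grid. -/
abbrev grid (k l : ℕ) : SimpleGraph (Fin k × Fin l) :=
  (SimpleGraph.pathGraph k).boxProd (SimpleGraph.pathGraph l)

/-- A qubit of the hardware: its cell `(row, column)` and its position inside the cell,
`Sum.inl d` in the left half or `Sum.inr d` in the right half. -/
abbrev Qubit (m c : ℕ) : Type := (Fin m × Fin m) × (Fin c ⊕ Fin c)

/-- Adjacency of qubits: every cell is a complete bipartite graph between its two halves; a left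
qubit is joined to its images in the cells directly above and below, a right qubit to its images
in the cells directly to the left and to the right. -/
def hardwareAdj (m c : ℕ) : Qubit m c → Qubit m c → Prop
  | ((a, b), Sum.inl d), ((a', b'), Sum.inl d') =>
      (SimpleGraph.pathGraph m).Adj a a' ∧ b = b' ∧ d = d'
  | ((a, b), Sum.inr d), ((a', b'), Sum.inr d') =>
      a = a' ∧ (SimpleGraph.pathGraph m).Adj b b' ∧ d = d'
  | ((a, b), Sum.inl _), ((a', b'), Sum.inr _) => a = a' ∧ b = b'
  | ((a, b), Sum.inr _), ((a', b'), Sum.inl _) => a = a' ∧ b = b'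

/-- The hardware graph `F(m,c)`: an `m × m` array of cells `K_{c,c}`. -/
def hardwareGraph (m c : ℕ) : SimpleGraph (Qubit m c) where
  Adj := hardwareAdj m c
  symm := ⟨by
    rintro ⟨⟨a, b⟩, d | d⟩ ⟨⟨a', b'⟩, d' | d'⟩ h
    · exact ⟨h.1.symm, h.2.1.symm, h.2.2.symm⟩
    · exact ⟨h.1.symm, h.2.symm⟩
    · exact ⟨h.1.symm, h.2.symm⟩
    · exact ⟨h.1.symm, h.2.1.symm, h.2.2.symm⟩⟩
  loopless := ⟨by
    rintro ⟨⟨a, b⟩, d | d⟩ h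
    · exact (SimpleGraph.pathGraph m).irrefl h.1
    · exact (SimpleGraph.pathGraph m).irrefl h.2.1⟩

end QuantumEmbedding

/-!
Counting qubits rules out the embedding. In a minor embedding the branch sets are nonempty and
pairwise disjoint, so the grid, with `c² (m + 1)²` vertices, needs at least that many of the
`2 c m²` qubits; for `c ≥ 2` there are too few of them.

For `c = 1` this bound is not enough, but then every qubit has at most three neighbours: two along
its line and one in its cell. A vertex of degree four therefore cannot be represented by a single
qubit, because its four neighbours lie in disjoint branch sets. The `(m - 1)²` interior vertices of
the `(m + 1) × (m + 1)` grid have degree four, so the embedding would use at least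
`(m + 1)² + (m - 1)² = 2 m² + 2` of the `2 m²` qubits. The counting step is
`IsBranchModel.card_add_card_le`.

Connectedness of the branch sets plays no role, so the argument is carried out for models with
arbitrary nonempty branch sets (`IsBranchModel`). These compose, which reduces both hypotheses on
the problem graph to a model of the grid in the hardware graph.
-/

namespace QuantumEmbedding

/-- The part of a minor embedding that counting arguments see: the branch sets are nonempty and
pairwise disjoint, and every edge is realized. The branch sets need not be connected. -/
structure IsBranchModel {V W : Type*} (G : SimpleGraph V) (H : SimpleGraph W)
    (φ : V → Set W) : Prop where
  nonempty : ∀ v, (φ v).Nonempty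
  disjoint : ∀ u v, u ≠ v → Disjoint (φ u) (φ v)
  edge : ∀ u v, G.Adj u v → ∃ x ∈ φ u, ∃ y ∈ φ v, H.Adj x y

/-! ### Branch models -/

theorem IsMinorEmbedding.isBranchModel {V W : Type*} {G : SimpleGraph V} {H : SimpleGraph W}
    {φ : V → Set W} (h : IsMinorEmbedding G H φ) : IsBranchModel G H φ where
  nonempty v := by
    obtain ⟨T, hT, hv⟩ := h.subtree v
    obtain ⟨x⟩ := hT.connected.nonempty
    exact ⟨x, hv ▸ x.2⟩
  disjoint := h.disjoint
  edge := h.edge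

theorem IsBranchModel.of_copy {V W : Type*} {G : SimpleGraph V} {H : SimpleGraph W}
    (f : G.Copy H) : IsBranchModel G H (fun v => {f v}) where
  nonempty _ := Set.singleton_nonempty _
  disjoint _ _ huv := Set.disjoint_singleton.2 (f.injective.ne huv)
  edge u v huv := ⟨f u, rfl, f v, rfl, f.toHom.map_adj huv⟩

theorem IsBranchModel.comp {U V W : Type*} {G : SimpleGraph U} {H : SimpleGraph V}
    {K : SimpleGraph W} {ψ : U → Set V} {φ : V → Set W} (hφ : IsBranchModel H K φ)
    (hψ : IsBranchModel G H ψ) : IsBranchModel G K (fun u => ⋃ v ∈ ψ u, φ v) where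
  nonempty u := by
    obtain ⟨v, hv⟩ := hψ.nonempty u
    obtain ⟨w, hw⟩ := hφ.nonempty v
    exact ⟨w, Set.mem_biUnion hv hw⟩
  disjoint u u' huu' := by
    simp only [Set.disjoint_iUnion_left, Set.disjoint_iUnion_right]
    intro v' hv' v hv
    refine hφ.disjoint _ _ ?_
    rintro rfl
    exact Set.disjoint_left.1 (hψ.disjoint u u' huu') ‹_› ‹_›
  edge u u' huu' := by
    obtain ⟨v, hv, v', hv', hvv'⟩ := hψ.edge u u' huu'
    obtain ⟨w, hw, w', hw', hww'⟩ := hφ.edge v v' hvv'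
    exact ⟨w, Set.mem_biUnion hv hw, w', Set.mem_biUnion hv' hw', hww'⟩

/-- If a vertex `u` is represented by the single vertex `x`, then `x` has at least as many
neighbours as `u`. -/
theorem IsBranchModel.degree_le {V W : Type*} [Finite W] {G : SimpleGraph V} {H : SimpleGraph W}
    {φ : V → Set W} (h : IsBranchModel G H φ) {u : V} {x : W} (hu : φ u = {x}) :
    (G.neighborSet u).ncard ≤ (H.neighborSet x).ncard := by
  have key : ∀ v, ∃ y, G.Adj u v → y ∈ φ v ∧ H.Adj x y := by
    intro v
    by_cases huv : G.Adj u v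
    · obtain ⟨x', hx', y, hy, hxy⟩ := h.edge u v huv
      rw [hu, Set.mem_singleton_iff] at hx'
      exact ⟨y, fun _ => ⟨hy, hx' ▸ hxy⟩⟩
    · exact ⟨x, fun h' => absurd h' huv⟩
  choose f hf using key
  refine Set.ncard_le_ncard_of_injOn f (fun v hv => (hf v hv).2) ?_ (Set.toFinite _)
  intro v hv v' hv' hvv'
  by_contra hne
  exact Set.disjoint_left.1 (h.disjoint v v' hne) (hf v hv).1 (hvv' ▸ (hf v' hv').1)

/-- In a host of maximum degree at most `d`, every vertex of degree more than `d` occupies at least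
two host vertices by `IsBranchModel.degree_le`, and every other vertex at least one. -/
theorem IsBranchModel.card_add_card_le {V W : Type*} [Fintype V] [Fintype W] {G : SimpleGraph V}
    {H : SimpleGraph W} {φ : V → Set W} (h : IsBranchModel G H φ) {d : ℕ}
    (hd : ∀ x, (H.neighborSet x).ncard ≤ d) (s : Finset V)
    (hs : ∀ v ∈ s, d < (G.neighborSet v).ncard) :
    Fintype.card V + s.card ≤ Fintype.card W := by
  classical
  have hle : ∀ v, 1 + (if v ∈ s then 1 else 0) ≤ (φ v).toFinset.card := by
    intro v
    rw [← Set.ncard_eq_toFinset_card']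
    have hpos : 0 < (φ v).ncard := (Set.ncard_pos (Set.toFinite _)).2 (h.nonempty v)
    split_ifs with hv
    · by_contra hlt
      obtain ⟨x, hx⟩ := Set.ncard_eq_one.1 (show (φ v).ncard = 1 by omega)
      have := h.degree_le hx
      have := hd x
      have := hs v hv
      omega
    · omega
  calc Fintype.card V + s.card = ∑ v : V, (1 + if v ∈ s then 1 else 0) := by
        simp [Finset.sum_add_distrib]
    _ ≤ ∑ v : V, (φ v).toFinset.card := Finset.sum_le_sum fun v _ => hle v
    _ = (Finset.univ.biUnion fun v => (φ v).toFinset).card := by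
        refine (Finset.card_biUnion fun u _ v _ huv => ?_).symm
        exact Set.disjoint_toFinset.2 (h.disjoint u v huv)
    _ ≤ Fintype.card W := Finset.card_le_univ _

/-! ### Degrees in the hardware graph and in the grid -/

theorem ncard_neighborSet_pathGraph_le {n : ℕ} (a : Fin n) :
    ((SimpleGraph.pathGraph n).neighborSet a).ncard ≤ 2 := by
  refine (Set.ncard_le_ncard_of_injOn (t := {(a : ℕ) - 1, (a : ℕ) + 1}) Fin.val ?_
    Fin.val_injective.injOn (Set.toFinite _)).trans
    ((Set.ncard_insert_le _ _).trans (by rw [Set.ncard_singleton]))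
  intro b hb
  rw [SimpleGraph.mem_neighborSet, SimpleGraph.pathGraph_adj] at hb
  simp only [Set.mem_insert_iff, Set.mem_singleton_iff]
  omega

/-- A qubit has at most two neighbours along its line and `c` in its cell. -/
theorem ncard_neighborSet_hardwareGraph_le {m c : ℕ} (x : Qubit m c) :
    ((hardwareGraph m c).neighborSet x).ncard ≤ 2 + c := by
  have bound : ∀ (a : Fin m) (f : Fin m → Qubit m c) (g : Fin c → Qubit m c),
      (hardwareGraph m c).neighborSet x ⊆
        f '' (SimpleGraph.pathGraph m).neighborSet a ∪ g '' Set.univ →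
      ((hardwareGraph m c).neighborSet x).ncard ≤ 2 + c := by
    intro a f g hsub
    refine (Set.ncard_le_ncard hsub (Set.toFinite _)).trans
      ((Set.ncard_union_le _ _).trans (Nat.add_le_add ?_ ?_))
    · exact (Set.ncard_image_le (Set.toFinite _)).trans (ncard_neighborSet_pathGraph_le a)
    · exact (Set.ncard_image_le (Set.toFinite _)).trans (by simp [Set.ncard_univ])
  obtain ⟨⟨a, b⟩, d | d⟩ := x
  · refine bound a (fun a' => ((a', b), Sum.inl d)) (fun d' => ((a, b), Sum.inr d')) ?_
    rintro ⟨⟨a', b'⟩, d' | d'⟩ h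
    · obtain ⟨h, rfl, rfl⟩ := h
      exact Or.inl ⟨a', h, rfl⟩
    · obtain ⟨rfl, rfl⟩ := h
      exact Or.inr ⟨d', trivial, rfl⟩
  · refine bound b (fun b' => ((a, b'), Sum.inr d)) (fun d' => ((a, b), Sum.inl d')) ?_
    rintro ⟨⟨a', b'⟩, d' | d'⟩ h
    · obtain ⟨rfl, rfl⟩ := h
      exact Or.inr ⟨d', trivial, rfl⟩
    · obtain ⟨rfl, h, rfl⟩ := h
      exact Or.inl ⟨b', h, rfl⟩

/-- An interior vertex of the grid, given by its coordinates shifted down by one, has at least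
four neighbours. -/
theorem three_lt_ncard_neighborSet_grid {k l : ℕ} (i : Fin k) (j : Fin l) :
    3 < ((grid (k + 2) (l + 2)).neighborSet (i.succ.castSucc, j.succ.castSucc)).ncard := by
  have hsub : (({(i.castSucc.castSucc, j.succ.castSucc), (i.succ.succ, j.succ.castSucc),
      (i.succ.castSucc, j.castSucc.castSucc), (i.succ.castSucc, j.succ.succ)} :
        Finset (Fin (k + 2) × Fin (l + 2))) : Set (Fin (k + 2) × Fin (l + 2))) ⊆
      (grid (k + 2) (l + 2)).neighborSet (i.succ.castSucc, j.succ.castSucc) := by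
    intro p hp
    simp only [Finset.coe_insert, Finset.coe_singleton, Set.mem_insert_iff,
      Set.mem_singleton_iff] at hp
    rcases hp with rfl | rfl | rfl | rfl <;>
      simp [SimpleGraph.boxProd_adj, SimpleGraph.pathGraph_adj]
  refine lt_of_lt_of_le ?_ (Set.ncard_le_ncard hsub (Set.toFinite _))
  rw [Set.ncard_coe_finset, Finset.card_insert_of_notMem, Finset.card_insert_of_notMem,
    Finset.card_pair]
  · norm_num
  all_goals simp [Prod.ext_iff, Fin.ext_iff] <;> omega

/-! ### The grid in the hardware graph -/

theorem card_qubit (m c : ℕ) : Fintype.card (Qubit m c) = m * m * (c + c) := by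
  simp

theorem not_isBranchModel_grid {m c : ℕ} (hm : 1 ≤ m) (hc : 1 ≤ c)
    (φ : Fin (c * (m + 1)) × Fin (c * (m + 1)) → Set (Qubit m c)) :
    ¬ IsBranchModel (grid (c * (m + 1)) (c * (m + 1))) (hardwareGraph m c) φ := by
  intro h
  obtain rfl | hc2 : c = 1 ∨ 2 ≤ c := by omega
  · obtain ⟨k, rfl⟩ : ∃ k, m = k + 1 := ⟨m - 1, by omega⟩
    have hN : 1 * (k + 1 + 1) = k + 2 := by ring
    revert φ
    rw [hN]
    intro φ h
    let e : Fin k × Fin k ↪ Fin (k + 2) × Fin (k + 2) :=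
      ⟨fun p => (p.1.succ.castSucc, p.2.succ.castSucc), fun p q hpq => by
        simpa [Prod.ext_iff, Fin.ext_iff] using hpq⟩
    have hcard := h.card_add_card_le ncard_neighborSet_hardwareGraph_le (Finset.univ.map e) (by
      intro v hv
      obtain ⟨p, -, rfl⟩ := Finset.mem_map.1 hv
      exact three_lt_ncard_neighborSet_grid p.1 p.2)
    rw [card_qubit] at hcard
    simp only [Finset.card_map, Finset.card_univ, Fintype.card_prod, Fintype.card_fin] at hcard
    nlinarith
  · have hcard := h.card_add_card_le ncard_neighborSet_hardwareGraph_le ∅ (by simp)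
    rw [card_qubit] at hcard
    simp only [Finset.card_empty, Fintype.card_prod, Fintype.card_fin] at hcard
    have h1 : 2 * (c * ((m + 1) * (m + 1))) ≤ c * (c * ((m + 1) * (m + 1))) :=
      Nat.mul_le_mul_right _ hc2
    nlinarith [Nat.mul_pos hc hm]

end QuantumEmbedding

theorem corollary3 {V : Type*} [Fintype V] (P : Matrix V V ℝ) (hP : P.IsSymm)
    (m c : ℕ) (hm : 1 ≤ m) (hc : 1 ≤ c)
    (hgrid :
      (QuantumEmbedding.grid (c * (m + 1)) (c * (m + 1))).IsContained
          (QuantumEmbedding.problemGraph P hP) ∨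
        QuantumEmbedding.MinorEmbeddable (QuantumEmbedding.grid (c * (m + 1)) (c * (m + 1)))
          (QuantumEmbedding.problemGraph P hP)) :
    ¬ QuantumEmbedding.MinorEmbeddable (QuantumEmbedding.problemGraph P hP)
      (QuantumEmbedding.hardwareGraph m c) := by
  rintro ⟨φ, hφ⟩
  rcases hgrid with ⟨⟨f⟩⟩ | ⟨ψ, hψ⟩
  · exact QuantumEmbedding.not_isBranchModel_grid hm hc _
      (hφ.isBranchModel.comp (QuantumEmbedding.IsBranchModel.of_copy f))
  · exact QuantumEmbedding.not_isBranchModel_grid hm hc _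
      (hφ.isBranchModel.comp hψ.isBranchModel)
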